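/- All Hilbert spaces are finite dimensional and $\log$ is to base $2$. For quantum states $\rho,\sigma$ and $\varepsilon\in(0,1)$ let $$\mathrm D_{\mathrm H}^{\varepsilon}(\rho\|\sigma)=\max_{0\preceq M\preceq \mathbb I,\ \mathrm{Tr}[M\rho]\ge 1-\varepsilon}\bigl(-\log \mathrm{Tr}[M\sigma]\bigr)\in[0,+\infty],$$ and for a state $\rho_{BA'}$ and convex sets $S_B$, $S_{A'}$ of states on $B$ and $A'$ let $$\hat{\mathrm I}_{\mathrm H}^{\varepsilon,S_B,S_{A'}}(B:A')_{\rho_{BA'}}=\min_{\tau_B\in S_B,\ \sigma_{A'}\in S_{A'}}\mathrm D_{\mathrm H}^{\varepsilon}(\rho_{BA'}\|\tau_B\otimes\sigma_{A'}).$$ Let $s\ge 1$ and let $\mathcal N^{(1)},\dots,\mathcal N^{(s)}$ be quantum channels (completely positive trace preserving maps) from a register $A$ to a register $B$. For real $R$, an $(R,\delta)$-entanglement assisted code for the compound channel $\{\mathcal N^{(i)}\}_{i=1}^s$ with informed sender consists of a pure state $\theta_{E_AE_B}$ shared by sender and receiver, a message register $M$ with $2^R$ messages ($\lceil 2^R\rceil$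 messages if $2^R$ is not an integer), encoding channels $\mathcal E_i: ME_A\to A$ for $i=1,\dots,s$, and one decoding channel $\mathcal D: BE_B\to M'$ with $M'\equiv M$, which does not depend on $i$, such that $\Pr\{M'\ne m\mid M=m\}\le\delta$ for all messages $m$ and all $i$, when the sender encodes $m$ with $\mathcal E_i$ and the channel $\mathcal N^{(i)}$ is used. **Corollary 2.** Let $\varepsilon,\eta\in(0,1)$, let $A'\equiv A$, and fix pure states $|\psi^{(i)}\rangle\langle\psi^{(i)}|_{AA'}$ for $i=1,\dots,s$, with reduced states $\psi^{(i)}_A$ and $\psi^{(i)}_{A'}$. Put $$S_{A'}=\mathrm{conv}\{\psi^{(i)}_{A'}: 1\le i\le s\},\qquad S_B=\mathrm{conv}\{\mathcal N^{(i)}(\psi^{(i)}_A): 1\le i\le s\}.$$ Then for every real $R$ with $$R\le \min_{1\le i\le s}\left(\hat{\mathrm I}_{\mathrm H}^{\varepsilon,S_B,S_{A'}}(B:A')_{(\mathcal N^{(i)}\otimes\mathrm{id}_{A'})(|\psi^{(i)}\rangle\langle\psi^{(i)}|_{AA'})}+\log(2s)\,\log\frac{\eta}{6\log(2s)}+\log\frac{\varepsilon}{4s^2}\right)$$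 there exists an $(R,\varepsilon+3\eta)$-entanglement assisted code for the compound channel $\{\mathcal N^{(i)}\}_{i=1}^s$ with informed sender. -/

import Mathlib

open scoped Kronecker ComplexOrder

noncomputable section

namespace CompoundChannel

/-- The density matrix `|ψ⟩⟨ψ|` of a vector `ψ`; a register is given by a finite index type
of an orthonormal basis. -/
def pureState {X : Type*} [Fintype X] (ψ : EuclideanSpace ℂ X) : Matrix X X ℂ :=
  fun x y => ψ x * star (ψ y)

/-- Partial trace over the second register. -/
def traceRight {X Y : Type*} [Fintype Y] (ρ : Matrix (X × Y) (X × Y) ℂ) : Matrix X X ℂ :=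
  fun x x' => ∑ y, ρ (x, y) (x', y)

/-- Partial trace over the first register. -/
def traceLeft {X Y : Type*} [Fintype X] (ρ : Matrix (X × Y) (X × Y) ℂ) : Matrix Y Y ℂ :=
  fun y y' => ∑ x, ρ (x, y) (x, y')

/-- The action `N ⊗ id` of a linear map on operators of the register `X` on an operator of the
register `XK`. -/
def onFirst {X Y : Type*} (K : Type*) (N : Matrix X X ℂ →ₗ[ℂ] Matrix Y Y ℂ)
    (ρ : Matrix (X × K) (X × K) ℂ) : Matrix (Y × K) (Y × K) ℂ :=
  fun p q => N (fun x x' => ρ (x, p.2) (x', q.2)) p.1 q.1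

/-- A quantum channel: a completely positive and trace preserving linear map. -/
structure Channel (X Y : Type*) [Fintype X] [Fintype Y] where
  toLinearMap : Matrix X X ℂ →ₗ[ℂ] Matrix Y Y ℂ
  completelyPositive : ∀ (k : ℕ) (ρ : Matrix (X × Fin k) (X × Fin k) ℂ),
    ρ.PosSemidef → (onFirst (Fin k) toLinearMap ρ).PosSemidef
  tracePreserving : ∀ ρ : Matrix X X ℂ, (toLinearMap ρ).trace = ρ.trace

/-- `-log₂ x` for `x ≥ 0`, with value `+∞` at `x = 0`. -/
def negLogTwo (x : ℝ) : EReal :=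
  if 0 < x then ((-Real.logb 2 x : ℝ) : EReal) else ⊤

/-- The tests `0 ≤ M ≤ 1` with `Tr[M ρ] ≥ 1 - ε`. -/
def tests {X : Type*} [Fintype X] [DecidableEq X] (ε : ℝ) (ρ : Matrix X X ℂ) :
    Set (Matrix X X ℂ) :=
  {M | M.PosSemidef ∧ (1 - M).PosSemidef ∧ 1 - ε ≤ ((M * ρ).trace).re}

/-- The smooth quantum hypothesis testing divergence `D_H^ε(ρ ‖ σ)`. -/
def hypothesisTestingDivergence {X : Type*} [Fintype X] [DecidableEq X] (ε : ℝ)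
    (ρ σ : Matrix X X ℂ) : EReal :=
  ⨆ M ∈ tests ε ρ, negLogTwo ((M * σ).trace).re

/-- The quantity `Î_H^{ε,S_X,S_Y}(X:Y)_ρ`, the minimum of `D_H^ε(ρ_{XY} ‖ τ_X ⊗ σ_Y)` over
`τ_X ∈ S_X` and `σ_Y ∈ S_Y`. -/
def restrictedInformation {X Y : Type*} [Fintype X] [DecidableEq X] [Fintype Y] [DecidableEq Y]
    (ε : ℝ) (SX : Set (Matrix X X ℂ)) (SY : Set (Matrix Y Y ℂ))
    (ρ : Matrix (X × Y) (X × Y) ℂ) : EReal :=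
  ⨅ σ ∈ SY, ⨅ τ ∈ SX, hypothesisTestingDivergence ε ρ (τ ⊗ₖ σ)

/-- The state `|m⟩⟨m|_M ⊗ |θ⟩⟨θ|_{E_A E_B}`, the registers being grouped as `(M E_A) E_B`. -/
def messageState {M EA EB : Type*} [Fintype EA] [Fintype EB] [DecidableEq M]
    (θ : EuclideanSpace ℂ (EA × EB)) (m : M) :
    Matrix ((M × EA) × EB) ((M × EA) × EB) ℂ :=
  (Matrix.single m m (1 : ℂ) ⊗ₖ pureState θ).submatrix
    (Equiv.prodAssoc M EA EB) (Equiv.prodAssoc M EA EB)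

/-- The state of Bob's output register `M'` if the message is `m`, Alice encodes with `enc`, the
channel `N` acts, and Bob decodes with `dec`. -/
def outputState {M EA EB A B : Type*} [Fintype M] [DecidableEq M] [Fintype EA] [Fintype EB]
    [Fintype A] [Fintype B] (θ : EuclideanSpace ℂ (EA × EB)) (enc : Channel (M × EA) A)
    (N : Channel A B) (dec : Channel (B × EB) M) (m : M) : Matrix M M ℂ :=
  dec.toLinearMap (onFirst EB N.toLinearMap (onFirst EB enc.toLinearMap (messageState θ m)))

/-- `Pr{M' ≠ m | M = m}`, where `M'` is read off in the message basis. -/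
def errorProbability {M EA EB A B : Type*} [Fintype M] [DecidableEq M] [Fintype EA] [Fintype EB]
    [Fintype A] [Fintype B] (θ : EuclideanSpace ℂ (EA × EB)) (enc : Channel (M × EA) A)
    (N : Channel A B) (dec : Channel (B × EB) M) (m : M) : ℝ :=
  ∑ m' ∈ Finset.univ.erase m, (outputState θ enc N dec m m' m').re

/-- An `(R, δ)`-entanglement assisted code for the compound channel `N` in the case of an informed
sender. The message register has `2 ^ R` messages (rounded up if this is not an integer); the
encoder may depend on the index of the channel, while the shared pure state and the decoder may
not. -/
structure InformedSenderCode {s : ℕ} {A B : Type*} [Fintype A] [Fintype B]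
    (N : Fin s → Channel A B) (R δ : ℝ) where
  dimEA : ℕ
  dimEB : ℕ
  θ : EuclideanSpace ℂ (Fin dimEA × Fin dimEB)
  norm_θ : ‖θ‖ = 1
  enc : Fin s → Channel (Fin ⌈(2 : ℝ) ^ R⌉₊ × Fin dimEA) A
  dec : Channel (B × Fin dimEB) (Fin ⌈(2 : ℝ) ^ R⌉₊)
  error_le : ∀ m i, errorProbability θ (enc i) (N i) dec m ≤ δ

end CompoundChannel

end

/-! The code is position based. Sender and receiver share one copy of `ψ i` for every pair (i, m) of
a channel index and a message; to send m through channel i, the copy at (i, m) is fed into the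
channel. The receiver must find m without knowing i.

The condition on R provides, for each i, one test T_i that accepts the true output of channel i with
probability at least 1 - ε and accepts every product of some output N_k(ψ_k) with the reduced state
of ψ_i with probability less than 2^(-(R - c - 1)), where c is the additive penalty. The divergence
gives a test only against each single mixture over k; `exists_test_forall` exchanges the quantifiers
by separating convex sets.

The decoder is the pretty good measurement of the operators G_m, each summing over k the states
received from position (k, m). Its error is at most that of any binary test between the true state
and the rest of the sum (`prettyGood_le`), so it performs as well as T_i on position (i, m) although
it does not depend on i. At any other position (k, m') the channel output is uncorrelated with
register (i, m), so T_i sees exactly such a product. There are at most s times the number of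
messages such terms, whence the error is at most ε + s⌈2^R⌉ 2^(-(R - c - 1)) plus a regularisation,
and the penalty c makes this at most ε + 2η. -/

namespace CompoundChannel

/-! ### Trace inequalities and the pretty good measurement. -/

section Trace
variable {X : Type*} [Fintype X] [DecidableEq X]

open scoped MatrixOrder in
theorem exists_eq_conjTranspose_mul_self {P : Matrix X X ℂ} (hP : P.PosSemidef) :
    ∃ C : Matrix X X ℂ, P = C.conjTranspose * C := by
  refine ⟨CFC.sqrt P, ?_⟩
  have h : (CFC.sqrt P).PosSemidef := Matrix.nonneg_iff_posSemidef.1 (CFC.sqrt_nonneg P)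
  rw [h.isHermitian.eq, CFC.sqrt_mul_sqrt_self P hP.nonneg]

open scoped MatrixOrder in
theorem exists_posDef_sqrt {S : Matrix X X ℂ} (hS : S.PosDef) :
    ∃ H : Matrix X X ℂ, H.PosDef ∧ H * H = S := by
  have hH := CFC.sqrt_mul_sqrt_self S hS.posSemidef.nonneg
  have h : (CFC.sqrt S).PosSemidef := Matrix.nonneg_iff_posSemidef.1 (CFC.sqrt_nonneg S)
  refine ⟨CFC.sqrt S, h.posDef_iff_isUnit.2 ?_, hH⟩
  have := hS.isUnit
  rw [← hH] at this
  exact isUnit_of_mul_isUnit_left this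

theorem trace_mul_re_nonneg {P Q : Matrix X X ℂ} (hP : P.PosSemidef) (hQ : Q.PosSemidef) :
    0 ≤ ((P * Q).trace).re := by
  obtain ⟨C, rfl⟩ := exists_eq_conjTranspose_mul_self hP
  rw [Matrix.mul_assoc, Matrix.trace_mul_comm]
  exact (Complex.nonneg_iff.1 (hQ.mul_mul_conjTranspose_same C).trace_nonneg).1

/-- The square of a selfadjoint contraction `2 T - 1` is bounded by the identity. -/
theorem one_sub_sq_posSemidef {T : Matrix X X ℂ} (hT : T.PosSemidef) (hT' : (1 - T).PosSemidef) :
    (1 - (2 * T - 1) * (2 * T - 1)).PosSemidef := by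
  -- 1 - (2T - 1)² = 4T(1 - T), and T(1 - T) = T(1 - T)T + (1 - T)T(1 - T).
  have h1 := hT'.conjTranspose_mul_mul_same T
  have h2 := hT.conjTranspose_mul_mul_same (1 - T)
  rw [hT.isHermitian.eq] at h1
  rw [hT'.isHermitian.eq] at h2
  have h := (h1.add h2)
  have h4 := (h.add h).add (h.add h)
  convert h4 using 1
  noncomm_ring

/-- The error of the pretty good measurement is bounded by that of any test. -/
theorem prettyGood_le {A B H T : Matrix X X ℂ} (hA : A.IsHermitian) (hB : B.IsHermitian)
    (hH : H.PosDef) (hS : H * H = A + B) (hT : T.PosSemidef) (hT' : (1 - T).PosSemidef) :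
    ((A * H⁻¹ * B * H⁻¹).trace).re ≤ (((1 - T) * A).trace).re + ((T * B).trace).re := by
  have hdet : IsUnit H.det := (Matrix.isUnit_iff_isUnit_det H).1 hH.isUnit
  have hl : H⁻¹ * H = 1 := Matrix.nonsing_inv_mul H hdet
  have hr : H * H⁻¹ = 1 := Matrix.mul_nonsing_inv H hdet
  set K := H⁻¹ with hK
  have hKp : K.PosSemidef := hH.posSemidef.inv
  set W : Matrix X X ℂ := 2 * T - 1 with hW
  have hWh : W.IsHermitian := by
    have : W = T + T - 1 := by rw [hW]; noncomm_ring
    rw [this]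
    exact (hT.isHermitian.add hT.isHermitian).sub Matrix.isHermitian_one
  have hHh := hH.isHermitian
  -- Completing the square: with D = A - B, positivity of Tr[EKEK] bounds Tr[DKDK] from below by 2
  -- Tr[WD] - Tr[WHWH], which is linear in D. Since 4 Tr[AKBK] = Tr[A + B] - Tr[DKDK], only an upper
  -- bound on Tr[WHWH] is then needed.
  set E : Matrix X X ℂ := (A - B) - H * W * H with hE
  have hEh : E.IsHermitian := by
    refine (hA.sub hB).sub ?_
    rw [Matrix.IsHermitian, Matrix.conjTranspose_mul, Matrix.conjTranspose_mul, hHh.eq, hWh.eq,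
      Matrix.mul_assoc]
  have e1 : 0 ≤ ((E * K * E * K).trace).re := by
    have := hKp.conjTranspose_mul_mul_same E
    rw [hEh.eq] at this
    exact trace_mul_re_nonneg this hKp
  -- The commutator of W and H yields Tr[WHWH] ≤ Tr[HW²H], which is at most Tr[H²] = Tr[A + B]
  -- because W² ≤ 1.
  set C : Matrix X X ℂ := W * H - H * W with hC
  have e2 : 0 ≤ ((C.conjTranspose * C).trace).re :=
    (Complex.nonneg_iff.1 (Matrix.posSemidef_conjTranspose_mul_self C).trace_nonneg).1
  have hCh : C.conjTranspose = H * W - W * H := by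
    rw [hC, Matrix.conjTranspose_sub, Matrix.conjTranspose_mul, Matrix.conjTranspose_mul, hHh.eq,
      hWh.eq]
  rw [hCh] at e2
  have e3 : 0 ≤ ((H * (1 - W * W) * H).trace).re := by
    have := (one_sub_sq_posSemidef hT hT').conjTranspose_mul_mul_same H
    rw [hHh.eq] at this
    exact (Complex.nonneg_iff.1 this.trace_nonneg).1
  -- cyclicity of the trace
  have t1 : (E * K * E * K).trace
      = ((A - B) * K * (A - B) * K).trace - 2 * (W * (A - B)).trace + (W * H * W * H).trace := by
    have x1 : (A - B) * K * (H * W * H) * K = (A - B) * W := by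
      calc _ = (A - B) * (K * H) * W * (H * K) := by noncomm_ring
        _ = _ := by rw [hl, hr]; noncomm_ring
    have x2 : (H * W * H) * K * (A - B) * K = H * (W * (A - B) * K) := by
      calc _ = H * W * (H * K) * (A - B) * K := by noncomm_ring
        _ = _ := by rw [hr]; noncomm_ring
    have x3 : (H * W * H) * K * (H * W * H) * K = H * (W * H * W) := by
      calc _ = H * W * (H * K) * H * W * (H * K) := by noncomm_ring
        _ = _ := by rw [hr]; noncomm_ring
    have x4 : E * K * E * K = (A - B) * K * (A - B) * K - (A - B) * K * (H * W * H) * K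
        - (H * W * H) * K * (A - B) * K + (H * W * H) * K * (H * W * H) * K := by
      rw [hE]; noncomm_ring
    rw [x4, x1, x2, x3, Matrix.trace_add, Matrix.trace_sub, Matrix.trace_sub,
      Matrix.trace_mul_comm H (W * (A - B) * K), Matrix.trace_mul_comm H (W * H * W),
      Matrix.trace_mul_comm (A - B) W, Matrix.mul_assoc _ K H, hl, Matrix.mul_one]
    ring
  have t2 : ((A + B) * K * (A + B) * K).trace = (A + B).trace := by
    rw [← hS]
    congr 1
    calc _ = H * (H * K) * H * (H * K) := by noncomm_ring
      _ = _ := by rw [hr]; noncomm_ring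
  have t3 : 4 * (A * K * B * K).trace
      = ((A + B) * K * (A + B) * K).trace - ((A - B) * K * (A - B) * K).trace := by
    have : (A + B) * K * (A + B) * K - (A - B) * K * (A - B) * K
        = 2 • (A * K * B * K) + 2 • ((B * K) * (A * K)) := by noncomm_ring
    rw [← Matrix.trace_sub, this, Matrix.trace_add, Matrix.trace_smul, Matrix.trace_smul,
      Matrix.trace_mul_comm (B * K) (A * K)]
    simp only [Matrix.mul_assoc, nsmul_eq_mul, Nat.cast_ofNat]
    ring
  have t4 : ((H * W - W * H) * C).trace
      = 2 * (H * (W * W) * H).trace - 2 * (W * H * W * H).trace := by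
    have x1 : (H * W - W * H) * C = H * (W * W) * H - (H * W * H) * W - W * H * W * H
        + W * (H * H * W) := by
      rw [hC]; noncomm_ring
    rw [x1, Matrix.trace_add, Matrix.trace_sub, Matrix.trace_sub,
      Matrix.trace_mul_comm W (H * H * W), Matrix.trace_mul_comm (H * W * H) W,
      Matrix.mul_assoc (H * H) W W, Matrix.mul_assoc H H (W * W),
      Matrix.trace_mul_comm H (H * (W * W))]
    simp only [Matrix.mul_assoc]
    ring
  have t5 : (H * (1 - W * W) * H).trace = (A + B).trace - (H * (W * W) * H).trace := by
    rw [← hS, ← Matrix.trace_sub]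
    congr 1
    noncomm_ring
  have t6 : (W * (A - B)).trace = (A + B).trace - 2 * ((1 - T) * A).trace - 2 * (T * B).trace := by
    have : W * (A - B) = (A + B) - 2 • ((1 - T) * A) - 2 • (T * B) := by rw [hW]; noncomm_ring
    rw [this, Matrix.trace_sub, Matrix.trace_sub, Matrix.trace_smul, Matrix.trace_smul]
    simp
  have r1 := congrArg Complex.re t1
  have r2 := congrArg Complex.re t2
  have r3 := congrArg Complex.re t3
  have r4 := congrArg Complex.re t4
  have r5 := congrArg Complex.re t5
  have r6 := congrArg Complex.re t6
  simp only [Complex.add_re, Complex.sub_re, Complex.mul_re, Complex.re_ofNat, Complex.im_ofNat,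
    zero_mul, sub_zero] at r1 r2 r3 r4 r5 r6
  linarith

/-- The pretty good measurement for a family of hypotheses. -/
theorem exists_measurement {M : Type*} [Fintype M] [DecidableEq M] {G : M → Matrix X X ℂ}
    (hG : ∀ m, (G m).PosSemidef) (hS : (∑ m, G m).PosDef) :
    ∃ L : M → Matrix X X ℂ, (∀ m, (L m).PosSemidef) ∧ ∑ m, L m = 1 ∧
      ∀ (m : M) (A T : Matrix X X ℂ), A.PosSemidef → (G m - A).PosSemidef → T.PosSemidef →
        (1 - T).PosSemidef →
        ∑ m' ∈ Finset.univ.erase m, ((L m' * A).trace).re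
          ≤ (((1 - T) * A).trace).re + ((T * (∑ m', G m' - A)).trace).re := by
  obtain ⟨H, hH, hHS⟩ := exists_posDef_sqrt hS
  have hdet : IsUnit H.det := (Matrix.isUnit_iff_isUnit_det H).1 hH.isUnit
  have hl : H⁻¹ * H = 1 := Matrix.nonsing_inv_mul H hdet
  have hr : H * H⁻¹ = 1 := Matrix.mul_nonsing_inv H hdet
  have hKh : (H⁻¹).IsHermitian := hH.inv.isHermitian
  have hL : ∀ Q : Matrix X X ℂ, Q.PosSemidef → (H⁻¹ * Q * H⁻¹).PosSemidef := fun Q hQ => by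
    have := hQ.conjTranspose_mul_mul_same H⁻¹
    rwa [hKh.eq] at this
  have hsum : ∑ m, H⁻¹ * G m * H⁻¹ = 1 := by
    rw [← Finset.sum_mul, ← Finset.mul_sum, ← hHS]
    calc _ = (H⁻¹ * H) * (H * H⁻¹) := by noncomm_ring
      _ = 1 := by rw [hl, hr, Matrix.mul_one]
  refine ⟨fun m => H⁻¹ * G m * H⁻¹, fun m => hL _ (hG m), hsum, ?_⟩
  intro m A T hA hGA hT hT'
  set B := ∑ m', G m' - A with hB
  have hBh : B.IsHermitian := hS.isHermitian.sub hA.isHermitian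
  refine le_trans ?_ (prettyGood_le (H := H) hA.isHermitian hBh hH
    (by rw [hHS, hB]; abel) hT hT')
  -- The wrong outcomes carry B minus the part G m - A that already belongs to m; this part is
  -- positive, so dropping it only increases the error.
  have h1 : ∑ m' ∈ Finset.univ.erase m, ((H⁻¹ * G m' * H⁻¹ * A).trace).re
      = ((H⁻¹ * (B - (G m - A)) * H⁻¹ * A).trace).re := by
    have : B - (G m - A) = ∑ m' ∈ Finset.univ.erase m, G m' := by
      rw [hB, ← Finset.add_sum_erase _ _ (Finset.mem_univ m)]; abel
    rw [this, Finset.mul_sum, Finset.sum_mul, Finset.sum_mul, Matrix.trace_sum, Complex.re_sum]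
  have h2 := trace_mul_re_nonneg (hL _ hGA) hA
  have h3 : H⁻¹ * (B - (G m - A)) * H⁻¹ * A
      = H⁻¹ * B * H⁻¹ * A - H⁻¹ * (G m - A) * H⁻¹ * A := by noncomm_ring
  rw [h1, h3, Matrix.trace_sub, Complex.sub_re]
  have h4 : (A * H⁻¹ * B * H⁻¹).trace = (H⁻¹ * B * H⁻¹ * A).trace := by
    rw [Matrix.mul_assoc, Matrix.mul_assoc, Matrix.trace_mul_comm]
    simp only [Matrix.mul_assoc]
  rw [h4]
  linarith

end Trace

/-! ### One test against all alternatives. -/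

section Minimax
variable {X : Type*} [Fintype X] [DecidableEq X]

theorem convex_tests (ε : ℝ) (ρ : Matrix X X ℂ) : Convex ℝ (tests ε ρ) := by
  rintro M ⟨hM1, hM2, hM3⟩ M' ⟨hM1', hM2', hM3'⟩ a b ha hb hab
  refine ⟨(hM1.smul ha).add (hM1'.smul hb), ?_, ?_⟩
  · have : 1 - (a • M + b • M') = a • (1 - M) + b • (1 - M') := by
      rw [smul_sub, smul_sub]
      have : (1 : Matrix X X ℂ) = a • 1 + b • 1 := by rw [← add_smul, hab, one_smul]
      nth_rewrite 1 [this]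
      abel
    rw [this]
    exact (hM2.smul ha).add (hM2'.smul hb)
  · rw [add_mul, Matrix.smul_mul, Matrix.smul_mul, Matrix.trace_add, Matrix.trace_smul,
      Matrix.trace_smul, Complex.add_re, Complex.real_smul, Complex.real_smul,
      Complex.re_ofReal_mul, Complex.re_ofReal_mul]
    have h1 := mul_le_mul_of_nonneg_left hM3 ha
    have h2 := mul_le_mul_of_nonneg_left hM3' hb
    have h3 : a * (1 - ε) + b * (1 - ε) = 1 - ε := by rw [← add_mul, hab, one_mul]
    linarith

/-- If every mixture of finitely many alternatives can be told from `ρ` by a test, then one test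
does so for all the alternatives at once. -/
theorem exists_test_forall {ι : Type*} [Fintype ι] [Nonempty ι] {ε l : ℝ} {ρ : Matrix X X ℂ}
    {σ : ι → Matrix X X ℂ}
    (h : ∀ w : ι → ℝ, (∀ i, 0 ≤ w i) → ∑ i, w i = 1 →
      ∃ M ∈ tests ε ρ, ((M * ∑ i, w i • σ i).trace).re < l) :
    ∃ M ∈ tests ε ρ, ∀ i, ((M * σ i).trace).re < l := by
  classical
  let g : Matrix X X ℂ →ₗ[ℝ] (ι → ℝ) :=
    { toFun := fun M i => ((M * σ i).trace).re
      map_add' := fun M M' => by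
        ext i; simp [add_mul, Matrix.trace_add]
      map_smul' := fun a M => by
        ext i; simp [Matrix.trace_smul] }
  set U : Set (ι → ℝ) := {v | ∀ i, v i < l} with hU
  by_contra hcon
  push Not at hcon
  have hUo : IsOpen U := by
    have : U = Set.pi Set.univ fun _ => Set.Iio l := by ext v; simp [hU]
    rw [this]
    exact isOpen_set_pi Set.finite_univ fun _ _ => isOpen_Iio
  have hUc : Convex ℝ U := by
    have : U = Set.pi Set.univ fun _ => Set.Iio l := by ext v; simp [hU]
    rw [this]
    exact convex_pi fun _ _ => convex_Iio l
  have hdisj : Disjoint U (g '' tests ε ρ) := by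
    rw [Set.disjoint_left]
    rintro _ hv ⟨M, hM, rfl⟩
    obtain ⟨i, hi⟩ := hcon M hM
    exact absurd (hv i) (not_lt.2 hi)
  -- If no test works, the open orthant below l misses the convex set of acceptance vectors. As the
  -- orthant is open, no compactness of the tests is needed.
  obtain ⟨f, u, hf1, hf2⟩ := geometric_hahn_banach_open hUc hUo
    ((convex_tests ε ρ).linear_image g) hdisj
  set c : ι → ℝ := fun i => f (Pi.single i 1) with hc
  have hfc : ∀ v : ι → ℝ, f v = ∑ i, v i * c i := fun v => by
    conv_lhs => rw [pi_eq_sum_univ' v]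
    simp [hc, map_sum]
  have hu : ∀ x < l, x * ∑ i, c i < u := fun x hx => by
    have := hf1 (fun _ => x) (fun _ => hx)
    rwa [hfc, ← Finset.mul_sum] at this
  -- The orthant is unbounded below in each coordinate, so a negative coefficient would make f
  -- unbounded above on it.
  have hc0 : ∀ i, 0 ≤ c i := by
    intro i
    by_contra hneg
    push Not at hneg
    set x0 : ℝ := l - 1
    have key : ∀ t : ℝ, 0 ≤ t → x0 * ∑ j, c j - t * c i < u := fun t ht => by
      have := hf1 (fun j => x0 - t * Pi.single (M := fun _ => ℝ) i 1 j) (fun j => by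
        have : 0 ≤ Pi.single (M := fun _ => ℝ) i 1 j := by
          by_cases hj : j = i
          · subst hj; simp
          · simp [hj]
        have := mul_nonneg ht this
        simp only [x0]; linarith)
      rw [hfc] at this
      simpa [sub_mul, Finset.sum_sub_distrib, ← Finset.mul_sum, mul_assoc, Pi.single_apply] using this
    have h0 := key 0 le_rfl
    have := key ((u - x0 * ∑ j, c j) / (-c i)) (div_nonneg (by linarith) (by linarith))
    have h2 : (u - x0 * ∑ j, c j) / (-c i) * c i = -(u - x0 * ∑ j, c j) := by
      rw [div_neg, neg_mul, div_mul_cancel₀ _ hneg.ne]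
    rw [h2] at this
    linarith
  rcases (Finset.sum_nonneg fun i _ => hc0 i).eq_or_lt' with h0 | hpos
  -- A vanishing functional separates nothing once some test exists; one is taken from the
  -- hypothesis at a vertex of the simplex.
  · have hcz : ∀ i, c i = 0 := fun i =>
      (Finset.sum_eq_zero_iff_of_nonneg fun i _ => hc0 i).1 h0 i (Finset.mem_univ i)
    have h1 := hu (l - 1) (by linarith)
    obtain ⟨i⟩ := ‹Nonempty ι›
    obtain ⟨M, hM, -⟩ := h (Pi.single i 1) (fun j => by
      by_cases hj : j = i
      · subst hj; simp
      · simp [hj]) (by simp)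
    have := hf2 _ ⟨M, hM, rfl⟩
    rw [hfc] at this
    simp only [hcz, mul_zero, Finset.sum_const_zero] at this h1
    linarith
  -- The normalised separating functional is the mixture for which the hypothesis fails.
  · set s := ∑ i, c i with hs
    obtain ⟨M, hM, hMl⟩ := h (fun i => c i / s) (fun i => div_nonneg (hc0 i) hpos.le)
      (by rw [← Finset.sum_div, div_self hpos.ne'])
    have h1 := hf2 _ ⟨M, hM, rfl⟩
    have h2 : f (g M) = s * ((M * ∑ i, (c i / s) • σ i).trace).re := by
      rw [hfc, Finset.mul_sum, Matrix.trace_sum, Complex.re_sum, Finset.mul_sum]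
      refine Finset.sum_congr rfl fun i _ => ?_
      rw [Matrix.mul_smul, Matrix.trace_smul, Complex.real_smul, Complex.re_ofReal_mul]
      simp only [g, LinearMap.coe_mk, AddHom.coe_mk]
      field_simp
    obtain ⟨x, hx1, hx2⟩ := exists_between hMl
    have h3 := hu x hx2
    rw [h2] at h1
    have := mul_lt_mul_of_pos_left hx1 hpos
    linarith [mul_comm s x]

end Minimax

noncomputable section

/-! ### Relabelling, selection and measurement channels. -/

section Channels

theorem traceLeft_posSemidef {X Y : Type*} [Fintype X] {ρ : Matrix (X × Y) (X × Y) ℂ} (hρ : ρ.PosSemidef) :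
    (traceLeft ρ).PosSemidef := by
  have : (∑ x, ρ.submatrix (fun y => (x, y)) (fun y => (x, y))).PosSemidef :=
    Matrix.posSemidef_sum _ fun x _ => hρ.submatrix _
  convert this using 1
  ext y y'
  simp [traceLeft, Matrix.sum_apply]

variable {X Y Z M A B : Type*} [Fintype X] [Fintype Y] [Fintype Z] [Fintype M] [Fintype A]
  [Fintype B]

theorem Channel.onFirst_posSemidef (N : Channel X Y) {K : Type*} [Fintype K]
    {ρ : Matrix (X × K) (X × K) ℂ} (hρ : ρ.PosSemidef) :
    (onFirst K N.toLinearMap ρ).PosSemidef := by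
  let e := Fintype.equivFin K
  have h := N.completelyPositive _ _ (hρ.submatrix fun p : X × Fin _ => (p.1, e.symm p.2))
  have h' := h.submatrix fun p : Y × K => (p.1, e p.2)
  convert h' using 1
  ext p q
  simp [onFirst, Matrix.submatrix_apply]

/-- Relabelling the input basis of a channel. -/
def Channel.relabel (N : Channel X Y) (e : X ≃ Z) : Channel Z Y where
  toLinearMap :=
    { toFun := fun ρ => N.toLinearMap (ρ.submatrix e e)
      map_add' := fun ρ ρ' => by rw [← map_add]; rfl
      map_smul' := fun c ρ => by rw [RingHom.id_apply, ← map_smul]; rfl }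
  completelyPositive := fun k ρ hρ =>
    N.completelyPositive k _ (hρ.submatrix fun p : X × Fin k => (e p.1, p.2))
  tracePreserving := fun ρ => by
    refine (N.tracePreserving _).trans ?_
    exact e.sum_comp fun z => ρ z z

/-- The channel that reads a classical message `m` and then keeps the part of the register `Z`
which `e m` identifies with `A`. -/
def selectChannel {H : M → Type*} [∀ m, Fintype (H m)] (e : ∀ m, A × H m ≃ Z) :
    Channel (M × Z) A where
  toLinearMap :=
    { toFun := fun ρ => Matrix.of fun a a' => ∑ m, ∑ h : H m, ρ (m, e m (a, h)) (m, e m (a', h))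
      map_add' := fun ρ ρ' => by
        ext a a'
        simp [Finset.sum_add_distrib]
      map_smul' := fun c ρ => by
        ext a a'
        simp [Finset.mul_sum] }
  completelyPositive := fun k ρ hρ => by
    have : (∑ m, ∑ h : H m, ρ.submatrix (fun p : A × Fin k => ((m, e m (p.1, h)), p.2))
        (fun p : A × Fin k => ((m, e m (p.1, h)), p.2))).PosSemidef :=
      Matrix.posSemidef_sum _ fun m _ => Matrix.posSemidef_sum _ fun h _ => hρ.submatrix _
    convert this using 1
    ext p q
    simp [onFirst, Matrix.sum_apply]
  tracePreserving := fun ρ => by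
    simp only [Matrix.trace, Matrix.diag, LinearMap.coe_mk, AddHom.coe_mk, Matrix.of_apply]
    rw [Finset.sum_comm, Fintype.sum_prod_type]
    refine Finset.sum_congr rfl fun m _ => ?_
    rw [← (e m).sum_comp, Fintype.sum_prod_type]

theorem trace_kronecker_one_mul [DecidableEq Y] (L : Matrix X X ℂ)
    (ρ : Matrix (X × Y) (X × Y) ℂ) :
    ((L ⊗ₖ (1 : Matrix Y Y ℂ)) * ρ).trace = (L * traceRight ρ).trace := by
  simp only [Matrix.trace, Matrix.diag, Matrix.mul_apply, Matrix.kroneckerMap_apply,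
    Fintype.sum_prod_type, traceRight, Matrix.one_apply, mul_ite, mul_one, mul_zero, ite_mul,
    zero_mul, Finset.sum_ite_eq, Finset.mem_univ, if_true, Finset.mul_sum]
  exact Finset.sum_congr rfl fun x _ => Finset.sum_comm

/-- A measurement as a channel to a classical register. -/
def measurementChannel [DecidableEq X] [DecidableEq M] (L : M → Matrix X X ℂ)
    (hL : ∀ m, (L m).PosSemidef)
    (hsum : ∑ m, L m = 1) : Channel X M where
  toLinearMap :=
    { toFun := fun ρ => Matrix.diagonal fun m => (L m * ρ).trace
      map_add' := fun ρ ρ' => by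
        rw [Matrix.diagonal_add]; congr 1; ext m
        rw [mul_add, Matrix.trace_add]
      map_smul' := fun c ρ => by
        rw [RingHom.id_apply, ← Matrix.diagonal_smul]; congr 1; ext m
        rw [Matrix.mul_smul, Matrix.trace_smul]; rfl }
  completelyPositive := fun k ρ hρ => by
    -- With L m = Cᴴ C, the output is the sum over m of |m⟩⟨m| tensored with the partial trace of (C
    -- ⊗ 1) ρ (C ⊗ 1)ᴴ, which is manifestly positive.
    choose C hC using fun m => exists_eq_conjTranspose_mul_self (hL m)
    let D : M → Matrix (X × Fin k) (X × Fin k) ℂ := fun m => C m ⊗ₖ (1 : Matrix (Fin k) (Fin k) ℂ)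
    have : (∑ m, Matrix.diagonal (Pi.single m (1 : ℂ)) ⊗ₖ
        traceLeft (D m * ρ * (D m).conjTranspose)).PosSemidef :=
      Matrix.posSemidef_sum _ fun m _ => (Matrix.PosSemidef.diagonal (fun j => by
        by_cases hj : j = m
        · subst hj; simp
        · simp [hj])).kronecker (traceLeft_posSemidef (hρ.mul_mul_conjTranspose_same _))
    convert this using 1
    have key : ∀ m y y', traceLeft (D m * ρ * (D m).conjTranspose) y y'
        = (L m * (Matrix.of fun x x' => ρ (x, y) (x', y'))).trace := by
      intro m y y'
      rw [hC m, Matrix.mul_assoc (C m).conjTranspose, Matrix.trace_mul_comm (C m).conjTranspose]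
      simp only [traceLeft, Matrix.trace, Matrix.diag]
      refine Finset.sum_congr rfl fun x _ => ?_
      simp only [Matrix.mul_apply, D, Matrix.kroneckerMap_apply, Fintype.sum_prod_type,
        Matrix.one_apply, mul_ite, mul_one, mul_zero, ite_mul, zero_mul, Finset.sum_ite_eq,
        Finset.mem_univ, if_true, Matrix.conjTranspose_apply, apply_ite star, star_zero,
        Matrix.of_apply]
    ext p q
    rw [Matrix.sum_apply]
    simp only [Matrix.kroneckerMap_apply, key]
    rw [Finset.sum_eq_single p.1]
    · by_cases h : p.1 = q.1
      · simp [onFirst, h]; rfl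
      · simp [onFirst, h]
    · intro m _ hm
      rw [Matrix.diagonal_apply]
      simp [Ne.symm hm]
    · simp
  tracePreserving := fun ρ => by
    simp only [LinearMap.coe_mk, AddHom.coe_mk, Matrix.trace_diagonal]
    rw [← Matrix.trace_sum, ← Finset.sum_mul, hsum, one_mul]

/-- The entangled registers of a code may be any finite types. -/
theorem nonempty_informedSenderCode {s : ℕ} {EA EB : Type*} [Fintype EA] [Fintype EB]
    {N : Fin s → Channel A B} {R δ : ℝ} (θ : EuclideanSpace ℂ (EA × EB)) (hθ : ‖θ‖ = 1)
    (enc : Fin s → Channel (Fin ⌈(2 : ℝ) ^ R⌉₊ × EA) A)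
    (dec : Channel (B × EB) (Fin ⌈(2 : ℝ) ^ R⌉₊))
    (h : ∀ m i, errorProbability θ (enc i) (N i) dec m ≤ δ) :
    Nonempty (InformedSenderCode N R δ) := by
  let eA := Fintype.equivFin EA
  let eB := Fintype.equivFin EB
  refine ⟨⟨_, _, WithLp.toLp 2 fun p : Fin _ × Fin _ => θ (eA.symm p.1, eB.symm p.2), ?_,
    fun i => (enc i).relabel ((Equiv.refl _).prodCongr eA),
    dec.relabel ((Equiv.refl _).prodCongr eB), fun m i => ?_⟩⟩
  · rw [← hθ, EuclideanSpace.norm_eq, EuclideanSpace.norm_eq]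
    congr 1
    exact (eA.symm.prodCongr eB.symm).sum_comp fun p => ‖θ p‖ ^ 2
  · refine le_trans (le_of_eq ?_) (h m i)
    refine Finset.sum_congr rfl fun m' _ => ?_
    refine congrArg (fun Z => (dec.toLinearMap Z m' m').re) ?_
    ext p q
    refine congrArg (fun Z => (N i).toLinearMap Z p.1 q.1) ?_
    ext x x'
    refine congrArg (fun Z => (enc i).toLinearMap Z x x') ?_
    ext y y'
    change Matrix.single m m (1 : ℂ) y.1 y'.1 * (θ (eA.symm (eA y.2), eB.symm (eB p.2))
        * star (θ (eA.symm (eA y'.2), eB.symm (eB q.2))))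
      = Matrix.single m m (1 : ℂ) y.1 y'.1 * (θ (y.2, p.2) * star (θ (y'.2, q.2)))
    simp only [Equiv.symm_apply_apply]

end Channels

/-! ### Shared product states and the states received from them. -/

section ProductStates

variable {X : Type*} [Fintype X]

theorem pureState_posSemidef (φ : EuclideanSpace ℂ X) : (pureState φ).PosSemidef :=
  Matrix.posSemidef_vecMulVec_self_star (R := ℂ) (n := X) φ

theorem pureState_trace {φ : EuclideanSpace ℂ X} (hφ : ‖φ‖ = 1) : (pureState φ).trace = 1 := by
  have h : ‖φ‖ ^ 2 = 1 := by rw [hφ, one_pow]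
  rw [EuclideanSpace.norm_sq_eq] at h
  have : (pureState φ).trace = ((∑ x, ‖φ x‖ ^ 2 : ℝ) : ℂ) := by
    rw [Complex.ofReal_sum]
    refine Finset.sum_congr rfl fun x _ => ?_
    rw [Matrix.diag_apply, pureState]
    exact (Complex.mul_conj' _).trans (by norm_cast)
  rw [this, h, Complex.ofReal_one]

theorem traceLeft_trace {Y : Type*} [Fintype Y] (ρ : Matrix (X × Y) (X × Y) ℂ) :
    (traceLeft ρ).trace = ρ.trace := by
  simp only [Matrix.trace, Matrix.diag, traceLeft]
  rw [Finset.sum_comm, Fintype.sum_prod_type]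

variable {A B P : Type*} [Fintype A] [Fintype B] [Fintype P]

/-- The tensor product of bipartite vectors indexed by `P`, with the first registers and the
second registers grouped together. -/
def productVector (φ : P → EuclideanSpace ℂ (A × A)) : EuclideanSpace ℂ ((P → A) × (P → A)) :=
  WithLp.toLp 2 fun z => ∏ p, φ p (z.1 p, z.2 p)

variable [DecidableEq P]

theorem traceLeft_productVector (φ : P → EuclideanSpace ℂ (A × A)) (f f' : P → A) :
    traceLeft (pureState (productVector φ)) f f'
      = ∏ p, traceLeft (pureState (φ p)) (f p) (f' p) := by
  simp only [traceLeft, pureState, productVector, star_prod, ← Finset.prod_mul_distrib]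
  rw [Fintype.prod_sum]

theorem norm_productVector {φ : P → EuclideanSpace ℂ (A × A)} (hφ : ∀ p, ‖φ p‖ = 1) :
    ‖productVector φ‖ = 1 := by
  have h : ∀ p, ∑ x, ‖φ p x‖ ^ 2 = 1 := fun p => by
    rw [← EuclideanSpace.norm_sq_eq, hφ, one_pow]
  rw [EuclideanSpace.norm_eq, Real.sqrt_eq_one]
  simp only [productVector, norm_prod, ← Finset.prod_pow]
  rw [← (Equiv.arrowProdEquivProdArrow P (fun _ => A) (fun _ => A)).sum_comp]
  simp only [Equiv.arrowProdEquivProdArrow_apply, Prod.mk.eta]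
  rw [← Fintype.prod_sum (fun p x => ‖φ p x‖ ^ 2)]
  simp [h]

/-- The state of Bob's registers when the channel `N` has acted on Alice's part of the `p`-th
state, all her other registers being discarded. -/
def receivedState (φ : P → EuclideanSpace ℂ (A × A)) (N : Channel A B) (p : P) :
    Matrix (B × (P → A)) (B × (P → A)) ℂ :=
  fun x y => onFirst A N.toLinearMap (pureState (φ p)) (x.1, x.2 p) (y.1, y.2 p)
    * ∏ q : {q // q ≠ p}, traceLeft (pureState (φ q)) (x.2 q) (y.2 q)

/-- Bob's registers, with the one correlated with the channel output split off. -/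
def splitRegister (A B : Type*) {P : Type*} [DecidableEq P] (p : P) :
    B × (P → A) ≃ (B × A) × ({q // q ≠ p} → A) :=
  ((Equiv.refl B).prodCongr (Equiv.funSplitAt p A)).trans (Equiv.prodAssoc _ _ _).symm

omit [Fintype A] [Fintype B] [Fintype P] in
theorem splitRegister_apply (p : P) (x : B × (P → A)) :
    splitRegister A B p x = ((x.1, x.2 p), fun q : {q // q ≠ p} => x.2 q) := rfl

omit [Fintype A] [Fintype P] in
theorem funSplitAt_symm_self (p : P) (z : A × ({q // q ≠ p} → A)) :
    (Equiv.funSplitAt p A).symm z p = z.1 := by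
  conv_rhs => rw [← (Equiv.funSplitAt p A).apply_symm_apply z]
  rfl

omit [Fintype A] [Fintype P] in
theorem funSplitAt_symm_ne (p : P) (z : A × ({q // q ≠ p} → A)) (q : {q // q ≠ p}) :
    (Equiv.funSplitAt p A).symm z q = z.2 q := by
  conv_rhs => rw [← (Equiv.funSplitAt p A).apply_symm_apply z]
  rfl

theorem receivedState_eq_kronecker (φ : P → EuclideanSpace ℂ (A × A)) (N : Channel A B) (p : P) :
    receivedState φ N p = (onFirst A N.toLinearMap (pureState (φ p)) ⊗ₖ
      traceLeft (pureState (productVector fun q : {q // q ≠ p} => φ q))).submatrix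
        (splitRegister A B p) (splitRegister A B p) := by
  ext x y
  rw [Matrix.submatrix_apply, Matrix.kroneckerMap_apply, splitRegister_apply,
    splitRegister_apply, traceLeft_productVector, receivedState]

theorem receivedState_posSemidef (φ : P → EuclideanSpace ℂ (A × A)) (N : Channel A B) (p : P) :
    (receivedState φ N p).PosSemidef := by
  rw [receivedState_eq_kronecker]
  exact ((N.onFirst_posSemidef (pureState_posSemidef _)).kronecker
    (traceLeft_posSemidef (pureState_posSemidef _))).submatrix _

/-- Discarding all of the sender's registers but the selected one replaces every other shared pair
by its reduced state, and the resulting scalar factor passes through `N` by linearity. -/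
theorem onFirst_encoder {M : Type*} [Fintype M] [DecidableEq M]
    (φ : P → EuclideanSpace ℂ (A × A)) (N : Channel A B) (pos : M → P) (m : M) :
    onFirst (P → A) N.toLinearMap (onFirst (P → A)
      (selectChannel fun m => (Equiv.funSplitAt (pos m) A).symm).toLinearMap
      (messageState (productVector φ) m)) = receivedState φ N (pos m) := by
  have h : ∀ x y : A × (P → A), onFirst (P → A)
      (selectChannel fun m => (Equiv.funSplitAt (pos m) A).symm).toLinearMap
      (messageState (productVector φ) m) x y
      = pureState (φ (pos m)) (x.1, x.2 (pos m)) (y.1, y.2 (pos m))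
        * ∏ q : {q // q ≠ pos m}, traceLeft (pureState (φ q)) (x.2 q) (y.2 q) := by
    intro x y
    have := traceLeft_productVector (fun q : {q // q ≠ pos m} => φ q) (fun q => x.2 q)
      (fun q => y.2 q)
    rw [← this]
    simp only [onFirst, selectChannel, LinearMap.coe_mk, AddHom.coe_mk, Matrix.of_apply]
    rw [Finset.sum_eq_single m]
    · rw [traceLeft, Finset.mul_sum]
      refine Finset.sum_congr rfl fun h _ => ?_
      simp only [messageState, Matrix.submatrix_apply, Matrix.kroneckerMap_apply,
        Equiv.prodAssoc_apply, Matrix.single_apply_same, one_mul, pureState, productVector]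
      rw [Fintype.prod_eq_mul_prod_subtype_ne
          (fun p => φ p ((Equiv.funSplitAt (pos m) A).symm (x.1, h) p, x.2 p)) (pos m),
        Fintype.prod_eq_mul_prod_subtype_ne
          (fun p => φ p ((Equiv.funSplitAt (pos m) A).symm (y.1, h) p, y.2 p)) (pos m)]
      simp only [funSplitAt_symm_self, funSplitAt_symm_ne, star_mul']
      ring
    · intro m' _ hm'
      refine Finset.sum_eq_zero fun h _ => ?_
      simp only [messageState, Matrix.submatrix_apply, Matrix.kroneckerMap_apply,
        Equiv.prodAssoc_apply]
      rw [Matrix.single_apply_of_row_ne (Ne.symm hm'), zero_mul]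
    · simp
  ext x y
  rw [receivedState, mul_comm, onFirst]
  have h2 : (Matrix.of fun a a' => onFirst (P → A)
      (selectChannel fun m => (Equiv.funSplitAt (pos m) A).symm).toLinearMap
      (messageState (productVector φ) m) (a, x.2) (a', y.2))
      = (∏ q : {q // q ≠ pos m}, traceLeft (pureState (φ q)) (x.2 q) (y.2 q)) •
        Matrix.of fun a a' => pureState (φ (pos m)) (a, x.2 (pos m)) (a', y.2 (pos m)) := by
    ext a a'
    rw [Matrix.of_apply, h, Matrix.smul_apply, Matrix.of_apply, smul_eq_mul, mul_comm]
  exact congrFun (congrFun ((congrArg N.toLinearMap h2).trans (map_smul _ _ _)) _) _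

theorem traceRight_receivedState_self {φ : P → EuclideanSpace ℂ (A × A)} (hφ : ∀ p, ‖φ p‖ = 1)
    (N : Channel A B) (p : P) :
    traceRight ((receivedState φ N p).submatrix (splitRegister A B p).symm
      (splitRegister A B p).symm) = onFirst A N.toLinearMap (pureState (φ p)) := by
  rw [receivedState_eq_kronecker]
  ext x y
  simp only [traceRight, Equiv.apply_symm_apply,
    Matrix.submatrix_apply, Matrix.kroneckerMap_apply]
  rw [← Finset.mul_sum]
  have : ∑ h, traceLeft (pureState (productVector fun q : {q // q ≠ p} => φ q)) h h = 1 :=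
    (traceLeft_trace _).trans (pureState_trace (norm_productVector fun q => hφ q))
  rw [this, mul_one]

theorem sum_onFirst_diag (N : Channel A B) (ρ : Matrix (A × A) (A × A) ℂ) (b b' : B) :
    ∑ x, onFirst A N.toLinearMap ρ (b, x) (b', x) = N.toLinearMap (traceRight ρ) b b' := by
  have : traceRight ρ = ∑ x, Matrix.of fun a a' => ρ (a, x) (a', x) := by
    ext a a'
    rw [Matrix.sum_apply]
    rfl
  rw [this, map_sum, Matrix.sum_apply]
  rfl

/-- The channel output is correlated only with register `p'`, which is traced out here; register `p`
keeps its own reduced state. This is the independence behind position based coding. -/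
theorem traceRight_receivedState_of_ne {φ : P → EuclideanSpace ℂ (A × A)} (hφ : ∀ p, ‖φ p‖ = 1)
    (N : Channel A B) {p p' : P} (hp : p' ≠ p) :
    traceRight ((receivedState φ N p').submatrix (splitRegister A B p).symm
      (splitRegister A B p).symm)
      = N.toLinearMap (traceRight (pureState (φ p'))) ⊗ₖ traceLeft (pureState (φ p)) := by
  ext ⟨b, a⟩ ⟨b', a'⟩
  -- For fixed b and b', the entry is a product of one factor per position, so the partial trace can
  -- be taken position by position.
  let g : P → A → A → ℂ := fun q x x' => if q = p'
    then onFirst A N.toLinearMap (pureState (φ p')) (b, x) (b', x')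
    else traceLeft (pureState (φ q)) x x'
  have h1 : ∀ f f' : P → A, receivedState φ N p' (b, f) (b', f') = ∏ q, g q (f q) (f' q) := by
    intro f f'
    rw [Fintype.prod_eq_mul_prod_subtype_ne _ p', receivedState]
    congr 1
    · simp [g]
    · exact Finset.prod_congr rfl fun q _ => by simp [g, q.2]
  have h2 : ∀ (a : A) (h : {q // q ≠ p} → A), (splitRegister A B p).symm ((b, a), h)
      = (b, (Equiv.funSplitAt p A).symm (a, h)) := fun _ _ => rfl
  have h2' : ∀ (a : A) (h : {q // q ≠ p} → A), (splitRegister A B p).symm ((b', a), h)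
      = (b', (Equiv.funSplitAt p A).symm (a, h)) := fun _ _ => rfl
  simp only [traceRight, Matrix.submatrix_apply, h2, h2', h1]
  simp only [Fintype.prod_eq_mul_prod_subtype_ne _ p, funSplitAt_symm_self, funSplitAt_symm_ne]
  rw [← Finset.mul_sum, ← Fintype.prod_sum (fun (q : {q // q ≠ p}) x => g q x x),
    Finset.prod_eq_single ⟨p', hp⟩]
  · simp only [g, if_neg hp.symm, if_true, Matrix.kroneckerMap_apply, sum_onFirst_diag]
    rw [mul_comm]
  · intro q _ hq
    have : (q : P) ≠ p' := fun h => hq (Subtype.ext h)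
    simp only [g, if_neg this]
    exact (traceLeft_trace _).trans (pureState_trace (hφ _))
  · exact fun h => absurd (Finset.mem_univ _) h

/-- A test on the channel output and the `p`-th register, as a test on all of Bob's registers. -/
def liftTest [DecidableEq A] (T : Matrix (B × A) (B × A) ℂ) (p : P) :
    Matrix (B × (P → A)) (B × (P → A)) ℂ :=
  (T ⊗ₖ (1 : Matrix ({q // q ≠ p} → A) ({q // q ≠ p} → A) ℂ)).submatrix
    (splitRegister A B p) (splitRegister A B p)

variable [DecidableEq A]

theorem liftTest_posSemidef {T : Matrix (B × A) (B × A) ℂ} (hT : T.PosSemidef) (p : P) :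
    (liftTest T p).PosSemidef :=
  (hT.kronecker Matrix.PosSemidef.one).submatrix _

omit [Fintype A] [Fintype B] in
theorem one_sub_liftTest [DecidableEq B] (T : Matrix (B × A) (B × A) ℂ) (p : P) :
    1 - liftTest T p = liftTest (1 - T) p := by
  have h : (1 : Matrix (B × (P → A)) (B × (P → A)) ℂ) = liftTest 1 p := by
    rw [liftTest, Matrix.one_kronecker_one, Matrix.submatrix_one_equiv]
  rw [h]
  ext x y
  simp only [liftTest, Matrix.sub_apply, Matrix.submatrix_apply, Matrix.kroneckerMap_apply, sub_mul]

theorem trace_liftTest_mul (T : Matrix (B × A) (B × A) ℂ) (p : P)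
    (ρ : Matrix (B × (P → A)) (B × (P → A)) ℂ) :
    (liftTest T p * ρ).trace = (T * traceRight
      (ρ.submatrix (splitRegister A B p).symm (splitRegister A B p).symm)).trace := by
  rw [← trace_kronecker_one_mul, liftTest]
  set e := splitRegister A B p
  set Y := ρ.submatrix e.symm e.symm with hY
  have : ρ = Y.submatrix e e := by ext; simp [hY]
  rw [this, Matrix.submatrix_mul_equiv]
  exact e.sum_comp fun x => (T ⊗ₖ (1 : Matrix ({q // q ≠ p} → A) ({q // q ≠ p} → A) ℂ) * Y) x x

end ProductStates
end

/-! ### The position based code and its error. -/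

section Coding

variable {A B : Type*} [Fintype A] [DecidableEq A] [Fintype B] [DecidableEq B]

omit [DecidableEq A] [DecidableEq B] in
theorem trace_onFirst_pureState (N : Channel A B) {φ : EuclideanSpace ℂ (A × A)} (hφ : ‖φ‖ = 1) :
    (onFirst A N.toLinearMap (pureState φ)).trace = 1 := by
  rw [Matrix.trace, Fintype.sum_prod_type]
  simp only [Matrix.diag_apply, sum_onFirst_diag]
  refine (N.tracePreserving _).trans (Eq.trans ?_ (pureState_trace hφ))
  rw [Matrix.trace, Matrix.trace, Fintype.sum_prod_type]
  rfl

/-- Position based coding: for every channel the message selects one of the shared states made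
for that channel, and the receiver decodes by a pretty good measurement. -/
theorem nonempty_code_of_tests {s : ℕ} {N : Fin s → Channel A B} {ε l δ R : ℝ} (hl : 0 ≤ l)
    (hδ : 0 < δ) {ψ : Fin s → EuclideanSpace ℂ (A × A)} (hψ : ∀ i, ‖ψ i‖ = 1)
    {T : Fin s → Matrix (B × A) (B × A) ℂ}
    (hT : ∀ i, T i ∈ tests ε (onFirst A (N i).toLinearMap (pureState (ψ i))))
    (hTl : ∀ i k, ((T i * ((N k).toLinearMap (traceRight (pureState (ψ k))) ⊗ₖ
      traceLeft (pureState (ψ i)))).trace).re ≤ l) :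
    Nonempty (InformedSenderCode N R (ε + s * ⌈(2 : ℝ) ^ R⌉₊ * l + δ)) := by
  classical
  have hMne : Nonempty (Fin ⌈(2 : ℝ) ^ R⌉₊) :=
    Fin.pos_iff_nonempty.1 (Nat.ceil_pos.2 (Real.rpow_pos_of_pos two_pos R))
  have hcard : ((⌈(2 : ℝ) ^ R⌉₊ : ℕ) : ℝ) = Fintype.card (Fin ⌈(2 : ℝ) ^ R⌉₊) := by simp
  rw [hcard]
  let M := Fin ⌈(2 : ℝ) ^ R⌉₊
  let φ : Fin s × M → EuclideanSpace ℂ (A × A) := fun p => ψ p.1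
  have hφ : ∀ p, ‖φ p‖ = 1 := fun p => hψ p.1
  let Z := B × (Fin s × M → A)
  let X : Fin s × M → Matrix Z Z ℂ := fun p => receivedState φ (N p.1) p
  have hX : ∀ p, (X p).PosSemidef := fun p => receivedState_posSemidef φ (N p.1) p
  set n : ℝ := Fintype.card M * Fintype.card Z with hn
  have hn0 : 0 ≤ n := by positivity
  -- The multiple δ' of the identity makes the sum of the G m invertible. It costs at most n δ' ≤ δ;
  -- the added 1 keeps the denominator nonzero even if `Z` is empty.
  set δ' : ℝ := δ / (n + 1) with hδ'
  have hδ'0 : 0 < δ' := by positivity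
  have hI : (δ' • (1 : Matrix Z Z ℂ)).PosDef := Matrix.PosDef.one.smul hδ'0
  -- Summing over k counts a correct message with a wrong channel index as a success.
  let G : M → Matrix Z Z ℂ := fun m => ∑ k, X (k, m) + δ' • 1
  have hG : ∀ m, (G m).PosDef := fun m =>
    Matrix.PosDef.posSemidef_add (Matrix.posSemidef_sum _ fun k _ => hX (k, m)) hI
  obtain ⟨L, hL, hLs, hLe⟩ := exists_measurement (fun m => (hG m).posSemidef)
    (Matrix.posDef_sum Finset.univ_nonempty fun m _ => hG m)
  refine nonempty_informedSenderCode (productVector φ) (norm_productVector hφ)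
    (fun i => selectChannel fun m : M => (Equiv.funSplitAt (i, m) A).symm)
    (measurementChannel L hL hLs) fun m i => ?_
  have hout : errorProbability (productVector φ)
      (selectChannel fun m : M => (Equiv.funSplitAt (i, m) A).symm) (N i)
      (measurementChannel L hL hLs) m
      = ∑ m' ∈ Finset.univ.erase m, ((L m' * X (i, m)).trace).re := by
    refine Finset.sum_congr rfl fun m' _ => ?_
    rw [outputState, onFirst_encoder φ (N i) (fun m => (i, m)) m]
    simp only [measurementChannel, LinearMap.coe_mk, AddHom.coe_mk, Matrix.diagonal_apply_eq]
    rfl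
  rw [hout]
  obtain ⟨hT0, hT1, hTε⟩ := hT i
  set U : Matrix Z Z ℂ := liftTest (T i) (i, m) with hU
  have hU0 : U.PosSemidef := liftTest_posSemidef hT0 _
  have hU1 : (1 - U).PosSemidef := by
    rw [hU, one_sub_liftTest]
    exact liftTest_posSemidef hT1 _
  have hGX : (G m - X (i, m)).PosSemidef := by
    have : G m - X (i, m) = ∑ k ∈ Finset.univ.erase i, X (k, m) + δ' • 1 := by
      simp only [G]
      rw [← Finset.add_sum_erase _ _ (Finset.mem_univ i)]
      abel
    rw [this]
    exact (Matrix.posSemidef_sum _ fun k _ => hX (k, m)).add hI.posSemidef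
  refine (hLe m _ U (hX (i, m)) hGX hU0 hU1).trans ?_
  have hfirst : (((1 - U) * X (i, m)).trace).re ≤ ε := by
    rw [hU, one_sub_liftTest, trace_liftTest_mul, traceRight_receivedState_self hφ, sub_mul,
      one_mul, Matrix.trace_sub, Complex.sub_re, trace_onFirst_pureState _ (hφ _), Complex.one_re]
    linarith
  have hcross : ∀ p ≠ (i, m), ((U * X p).trace).re ≤ l := fun p hp => by
    rw [hU, trace_liftTest_mul, traceRight_receivedState_of_ne hφ _ hp]
    exact hTl i p.1
  have hUtr : (U.trace).re ≤ Fintype.card Z := by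
    have := (Complex.nonneg_iff.1 hU1.trace_nonneg).1
    rw [Matrix.trace_sub, Complex.sub_re, Matrix.trace_one, Complex.natCast_re] at this
    linarith
  have hsum : ∑ m', G m' - X (i, m)
      = ∑ p ∈ Finset.univ.erase (i, m), X p + (Fintype.card M * δ') • 1 := by
    have : ∑ m', G m' = ∑ p, X p + (Fintype.card M * δ') • 1 := by
      simp only [G]
      rw [Finset.sum_add_distrib, Fintype.sum_prod_type_right, Finset.sum_const, Finset.card_univ,
        mul_smul, Nat.cast_smul_eq_nsmul]
    rw [this, ← Finset.add_sum_erase _ _ (Finset.mem_univ (i, m))]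
    abel
  have hsecond : ((U * (∑ m', G m' - X (i, m))).trace).re ≤ s * Fintype.card M * l + δ := by
    rw [hsum, mul_add, Finset.mul_sum, Matrix.trace_add, Matrix.trace_sum, Complex.add_re,
      Complex.re_sum, Matrix.mul_smul, mul_one, Matrix.trace_smul, Complex.real_smul,
      Complex.re_ofReal_mul]
    refine add_le_add ?_ ?_
    · refine (Finset.sum_le_card_nsmul _ _ l fun p hp => hcross p (Finset.ne_of_mem_erase hp)).trans
        ?_
      rw [nsmul_eq_mul]
      refine mul_le_mul_of_nonneg_right ?_ hl
      have : (Finset.univ.erase (i, m)).card ≤ s * Fintype.card M := by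
        refine (Finset.card_erase_le).trans ?_
        rw [Finset.card_univ, Fintype.card_prod, Fintype.card_fin]
      exact_mod_cast this
    · have h1 : Fintype.card M * δ' * (U.trace).re ≤ Fintype.card M * δ' * Fintype.card Z :=
        mul_le_mul_of_nonneg_left hUtr (by positivity)
      have h2 : Fintype.card M * δ' * Fintype.card Z = n * δ' := by rw [hn]; ring
      have h3 : (n + 1) * δ' = δ := by rw [hδ']; field_simp
      nlinarith
  linarith

end Coding

/-! ### From the information quantity to tests, and the choice of constants. -/

theorem re_lt_of_lt_negLogTwo {r x : ℝ} (h : (r : EReal) < negLogTwo x) : x < 2 ^ (-r) := by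
  rw [negLogTwo] at h
  split_ifs at h with hx
  · rw [EReal.coe_lt_coe_iff] at h
    rw [← Real.logb_lt_iff_lt_rpow one_lt_two hx]
    linarith
  · exact (not_lt.1 hx).trans_lt (Real.rpow_pos_of_pos two_pos _)

/-- With σ held fixed, a mixture of the products τ k ⊗ σ is again a product with first factor in the
convex hull, so the minimax argument concerns the first factor only. -/
theorem exists_test_of_lt_restrictedInformation {X Y ι : Type*} [Fintype X] [DecidableEq X]
    [Fintype Y] [DecidableEq Y] [Fintype ι] [Nonempty ι] {ε r : ℝ} {τ : ι → Matrix X X ℂ}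
    {σ : Matrix Y Y ℂ} {SY : Set (Matrix Y Y ℂ)} (hσ : σ ∈ SY)
    {ρ : Matrix (X × Y) (X × Y) ℂ}
    (h : (r : EReal) < restrictedInformation ε (convexHull ℝ (Set.range τ)) SY ρ) :
    ∃ M ∈ tests ε ρ, ∀ k, ((M * (τ k ⊗ₖ σ)).trace).re < 2 ^ (-r) := by
  refine exists_test_forall fun w hw0 hw1 => ?_
  have hmem : ∑ k, w k • τ k ∈ convexHull ℝ (Set.range τ) :=
    (convex_convexHull ℝ _).sum_mem (fun k _ => hw0 k) hw1
      fun k _ => subset_convexHull ℝ _ ⟨k, rfl⟩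
  have h2 := h.trans_le ((iInf₂_le σ hσ).trans (iInf₂_le _ hmem))
  rw [hypothesisTestingDivergence] at h2
  simp only [lt_iSup_iff] at h2
  obtain ⟨M, hM, hlt⟩ := h2
  refine ⟨M, hM, ?_⟩
  have : ∑ k, w k • (τ k ⊗ₖ σ) = (∑ k, w k • τ k) ⊗ₖ σ := by
    ext x y
    simp only [Matrix.sum_apply, Matrix.smul_apply, Matrix.kroneckerMap_apply, Finset.sum_mul,
      smul_mul_assoc]
  rw [this]
  exact re_lt_of_lt_negLogTwo hlt

/-- Since log(2s) ≥ 1, the first summand of the exponent contributes a factor at most η; the second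
contributes ε/(4s²), which absorbs 4s. -/
theorem four_mul_rpow_penalty_le {s : ℕ} (hs : 1 ≤ s) {ε η : ℝ} (hε : ε ∈ Set.Ioo (0 : ℝ) 1)
    (hη : η ∈ Set.Ioo (0 : ℝ) 1) :
    4 * (s : ℝ) * 2 ^ (Real.logb 2 (2 * s) * Real.logb 2 (η / (6 * Real.logb 2 (2 * s)))
      + Real.logb 2 (ε / (4 * (s : ℝ) ^ 2))) ≤ η := by
  obtain ⟨hε0, hε1⟩ := hε
  obtain ⟨hη0, hη1⟩ := hη
  have hs' : (1 : ℝ) ≤ s := by exact_mod_cast hs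
  set L := Real.logb 2 (2 * s) with hL
  have hL1 : 1 ≤ L := by
    rw [hL, Real.le_logb_iff_rpow_le one_lt_two (by positivity), Real.rpow_one]
    linarith
  have hx0 : 0 < η / (6 * L) := by positivity
  have hxη : η / (6 * L) ≤ η := div_le_self hη0.le (by linarith)
  rw [Real.rpow_add two_pos, mul_comm L, Real.rpow_mul two_pos.le,
    Real.rpow_logb two_pos (by norm_num) hx0, Real.rpow_logb two_pos (by norm_num) (by positivity)]
  have h1 : (η / (6 * L)) ^ L ≤ η := by
    refine le_trans ?_ hxη
    conv_rhs => rw [← Real.rpow_one (η / (6 * L))]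
    exact Real.rpow_le_rpow_of_exponent_ge hx0 (by linarith) hL1
  have h2 : 4 * (s : ℝ) * (ε / (4 * (s : ℝ) ^ 2)) ≤ 1 := by
    have : 4 * (s : ℝ) * (ε / (4 * (s : ℝ) ^ 2)) = ε / s := by field_simp
    rw [this, div_le_one (by linarith)]
    linarith
  calc 4 * (s : ℝ) * ((η / (6 * L)) ^ L * (ε / (4 * (s : ℝ) ^ 2)))
      = (4 * (s : ℝ) * (ε / (4 * (s : ℝ) ^ 2))) * (η / (6 * L)) ^ L := by ring
    _ ≤ 1 * η := mul_le_mul h2 h1 (Real.rpow_nonneg hx0.le _) zero_le_one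
    _ = η := one_mul η

end CompoundChannel

open CompoundChannel in
theorem corollary2 {A B : Type*} [Fintype A] [DecidableEq A] [Fintype B] [DecidableEq B]
    (s : ℕ) (hs : 1 ≤ s) (N : Fin s → Channel A B)
    (ε η : ℝ) (hε : ε ∈ Set.Ioo (0 : ℝ) 1) (hη : η ∈ Set.Ioo (0 : ℝ) 1)
    (ψ : Fin s → EuclideanSpace ℂ (A × A)) (hψ : ∀ i, ‖ψ i‖ = 1)
    (SA' : Set (Matrix A A ℂ))
    (hSA' : SA' = convexHull ℝ (Set.range fun i => traceLeft (pureState (ψ i))))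
    (SB : Set (Matrix B B ℂ))
    (hSB : SB = convexHull ℝ
      (Set.range fun i => (N i).toLinearMap (traceRight (pureState (ψ i)))))
    (R : ℝ)
    (hR : (R : EReal) ≤ ⨅ i : Fin s,
      (restrictedInformation ε SB SA' (onFirst A (N i).toLinearMap (pureState (ψ i)))
        + ((Real.logb 2 (2 * s) * Real.logb 2 (η / (6 * Real.logb 2 (2 * s)))
            + Real.logb 2 (ε / (4 * (s : ℝ) ^ 2)) : ℝ) : EReal))) :
    Nonempty (InformedSenderCode N R (ε + 3 * η)) := by
  have hne : Nonempty (Fin s) := Fin.pos_iff_nonempty.1 hs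
  set c : ℝ := Real.logb 2 (2 * s) * Real.logb 2 (η / (6 * Real.logb 2 (2 * s)))
    + Real.logb 2 (ε / (4 * (s : ℝ) ^ 2)) with hc
  have hbudget : 4 * (s : ℝ) * 2 ^ c ≤ η := four_mul_rpow_penalty_le hs hε hη
  -- Giving up one bit turns the weak inequality for R into a strict one, so a test is obtained
  -- without the supremum being attained.
  have htest : ∀ i, ∃ T ∈ tests ε (onFirst A (N i).toLinearMap (pureState (ψ i))), ∀ k,
      ((T * ((N k).toLinearMap (traceRight (pureState (ψ k))) ⊗ₖ
        traceLeft (pureState (ψ i)))).trace).re < 2 ^ (-(R - c - 1)) := fun i => by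
    refine exists_test_of_lt_restrictedInformation (SY := SA')
      (by rw [hSA']; exact subset_convexHull ℝ _ ⟨i, rfl⟩) ?_
    rw [← hSB]
    have h1 := EReal.sub_le_of_le_add (hR.trans (iInf_le _ i))
    refine lt_of_lt_of_le ?_ h1
    rw [← EReal.coe_sub, EReal.coe_lt_coe_iff]
    linarith
  choose T hT hTl using htest
  obtain ⟨C⟩ := nonempty_code_of_tests (R := R) (Real.rpow_nonneg zero_le_two _) hη.1 hψ hT
    fun i k => (hTl i k).le
  refine ⟨{ C with error_le := fun m i => ?_ }⟩
  -- For R ≤ 0 there is a single message and no error; the bound ⌈2^R⌉ ≤ 2 · 2^R used otherwise can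
  -- fail there.
  by_cases hR0 : R ≤ 0
  · have hone : ⌈(2 : ℝ) ^ R⌉₊ ≤ 1 := by
      rw [Nat.ceil_le, Nat.cast_one]
      exact Real.rpow_le_one_of_one_le_of_nonpos one_le_two hR0
    have : Subsingleton (Fin ⌈(2 : ℝ) ^ R⌉₊) := Fin.subsingleton_iff_le_one.2 hone
    rw [errorProbability, Finset.sum_eq_zero]
    · linarith [hε.1, hη.1]
    · intro m' hm'
      exact absurd (Subsingleton.elim m' m) (Finset.ne_of_mem_erase hm')
  · refine (C.error_le m i).trans ?_
    have hpow : 1 ≤ (2 : ℝ) ^ R := Real.one_le_rpow one_le_two (by linarith)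
    have hceil : (⌈(2 : ℝ) ^ R⌉₊ : ℝ) ≤ 2 * 2 ^ R := by
      linarith [Nat.ceil_lt_add_one (zero_le_one.trans hpow)]
    have hl : (2 : ℝ) ^ R * 2 ^ (-(R - c - 1)) = 2 * 2 ^ c := by
      rw [← Real.rpow_add two_pos, show R + -(R - c - 1) = c + 1 by ring,
        Real.rpow_add two_pos, Real.rpow_one, mul_comm]
    have : (s : ℝ) * ⌈(2 : ℝ) ^ R⌉₊ * 2 ^ (-(R - c - 1)) ≤ 4 * s * 2 ^ c := by
      calc (s : ℝ) * ⌈(2 : ℝ) ^ R⌉₊ * 2 ^ (-(R - c - 1))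
          ≤ s * (2 * 2 ^ R) * 2 ^ (-(R - c - 1)) := by gcongr
        _ = 2 * s * (2 ^ R * 2 ^ (-(R - c - 1))) := by ring
        _ = 4 * s * 2 ^ c := by rw [hl]; ring
    -- One factor 2 comes from rounding up and one from the lost bit, so the cross terms cost at
    -- most η; the regularisation costs another η.
    linarith [hη.1]
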